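/- Let $(X,\mu)$ be a $\sigma$-finite measure space, let $d\ge 1$, and let $\mathcal Y_1,\dots,\mathcal Y_d$ be real normed lattices (not assumed complete). Let $\mathcal M(X)$ be the space of measurable real-valued functions on $X$ modulo equality a.e. A linear or multilinear operator is called positive if it maps nonnegative elements to nonnegative elements. Let $T:\mathcal Y_1\times\dots\times\mathcal Y_d\to\mathcal M(X)$ be a positive multilinear operator, let $1\le q\le\infty$ with conjugate exponent $q'$ (so $1/q+1/q'=1$), and let $A,B\ge 0$ be real numbers. Assume: (i) ($T$ saturates $X$.) Every measurable $E\subseteq X$ of positive measure has a measurable subset $E'\subseteq E$ of positive measure for which there are nonnegative $h_j\in\mathcal Y_j$ with $T(h_1,\dots,h_d)>0$ a.e. on $E'$. (ii) For all nonnegative $f_j\in\mathcal Y_j$, $\;\|T(f_1,\dots,f_d)^{1/d}\|_{L^q(X)}\le A\,\big(\|f_1\|_{\mathcal Y_1}\cdots\|f_d\|_{\mathcal Y_d}\big)^{1/d}$. (iii) (Structural hypothesis with constant $B$.) There is a linear subspace $D$ of $\mathcal Y_1\times\dots\times\mathcal Y_d$ such that the tuples in $D$ with nonnegative entries are dense in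 the set of all tuples with nonnegative entries (in particular $D$ is dense), and such that for every $(f_1,\dots,f_d)\in D$ with nonnegative entries there are positive linear operators $S_j:\mathcal Y_j\to\mathcal M(X)$, which may depend on $(f_1,\dots,f_d)$, satisfying $$T(h_1,\dots,h_d)\le S_1h_1\cdots S_dh_d\quad\text{a.e. on } X, \text{ for all nonnegative } h_j\in\mathcal Y_j,$$ $$S_1f_1\cdots S_df_d\le B^d\,T(f_1,\dots,f_d)\quad\text{a.e. on } X.$$ Then for every nonnegative $M\in L^{q'}(X)$ with $\|M\|_{L^{q'}(X)}=1$ there are positive bounded linear operators $R_j:\mathcal Y_j\to L^1(X)$, $1\le j\le d$, such that $$M^d\,T(f_1,\dots,f_d)\le R_1f_1\cdots R_df_d\quad\text{a.e. on } X, \text{ for all nonnegative } f_j\in\mathcal Y_j,$$ and $\|R_j\|_{\mathcal Y_j\to L^1(X)}\le AB$ for every $j$. -/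

import Mathlib

open MeasureTheory
open scoped ENNReal NNReal

namespace MultilinearDuality

variable {X : Type*} [MeasurableSpace X] {μ : Measure X} {d : ℕ} {Y : Fin d → Type*}
  [∀ j, NormedAddCommGroup (Y j)] [∀ j, NormedSpace ℝ (Y j)] [∀ j, Lattice (Y j)]

/-- A multilinear operator into the space `𝓜(X)` of (classes of) measurable real functions is
positive if it sends tuples of nonnegative elements to nonnegative functions. -/
def IsPositive (T : MultilinearMap ℝ Y (X →ₘ[μ] ℝ)) : Prop :=
  ∀ f : ∀ j, Y j, (∀ j, 0 ≤ f j) → ∀ᵐ x ∂μ, 0 ≤ T f x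

/-- `T` saturates `X`: every measurable set of positive measure contains a measurable subset of
positive measure on which some `T h`, with `h` a nonnegative tuple, is a.e. positive. -/
def Saturates (T : MultilinearMap ℝ Y (X →ₘ[μ] ℝ)) : Prop :=
  ∀ E : Set X, MeasurableSet E → 0 < μ E →
    ∃ E' ⊆ E, MeasurableSet E' ∧ 0 < μ E' ∧
      ∃ h : ∀ j, Y j, (∀ j, 0 ≤ h j) ∧ ∀ᵐ x ∂μ, x ∈ E' → 0 < T h x

/-- The main norm bound: `‖T(f₁,…,f_d)^{1/d}‖_{L^q} ≤ A (‖f₁‖ ⋯ ‖f_d‖)^{1/d}` for all nonnegative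
`f_j`. -/
def NormBound (T : MultilinearMap ℝ Y (X →ₘ[μ] ℝ)) (q : ℝ≥0∞) (A : ℝ≥0) : Prop :=
  ∀ f : ∀ j, Y j, (∀ j, 0 ≤ f j) →
    eLpNorm (fun x => (T f x) ^ (1 / (d : ℝ))) q μ
      ≤ ENNReal.ofReal (A * (∏ j, ‖f j‖) ^ (1 / (d : ℝ)))

/-- The structural hypothesis with constant `B`. It concerns the nonnegative tuples `f` of a linear
subspace `D` of the product which are dense among all nonnegative tuples. (Every tuple is a
difference of nonnegative ones, so such a `D` is a dense subspace; every dense vector sublattice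
is such a `D`.) The operators `S j` may depend on `f`. -/
def StructuralHypothesis (T : MultilinearMap ℝ Y (X →ₘ[μ] ℝ)) (B : ℝ≥0) : Prop :=
  ∃ D : Submodule ℝ (∀ j, Y j),
    {f : ∀ j, Y j | ∀ j, 0 ≤ f j} ⊆ closure {f : ∀ j, Y j | f ∈ D ∧ ∀ j, 0 ≤ f j} ∧
    ∀ f ∈ D, (∀ j, 0 ≤ f j) →
      ∃ S : ∀ j, Y j →ₗ[ℝ] (X →ₘ[μ] ℝ),
        (∀ j, ∀ g : Y j, 0 ≤ g → ∀ᵐ x ∂μ, 0 ≤ S j g x) ∧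
        (∀ h : ∀ j, Y j, (∀ j, 0 ≤ h j) → ∀ᵐ x ∂μ, T h x ≤ ∏ j, S j (h j) x) ∧
        ∀ᵐ x ∂μ, ∏ j, S j (f j) x ≤ (B : ℝ) ^ d * T f x

end MultilinearDuality

/-!
The condition `M^d T(f) ≤ ∏ R_j f_j` for all nonnegative tuples `f` is linear in disguise. By the
inequality between arithmetic and geometric means, applied after rescaling the entries of `f` by
positive `t_j`, it is equivalent to `d M T(f)^{1/d} ≤ ∑ R_j f_j` a.e. for all nonnegative `f`, the
form used throughout (`pow_mul_le_prod_of_forall_rat`). The factorisation thus becomes an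
extension problem for positive functionals.

On the simple functions `X → ∏ Y_j` one seeks a positive linear functional `φ` with
`φ(h) ≤ A B ∑ ‖h_j‖` for constants `h ≥ 0` and `d ∫_E M T(f)^{1/d} ≤ φ(1_E f)` for `f ≥ 0`. By the
M. Riesz extension theorem (`exists_separating_functional`) it exists as soon as
`∑_i 1_{E_i} f_i ≤ h` a.e. implies `d ∑_i ∫_{E_i} M T(f_i)^{1/d} ≤ A B ∑ ‖h_j‖`. This key
inequality (`sum_setLIntegral_weightedRoot_le`) is where the structural hypothesis enters. If `h`
has dominating operators `S_j`, superadditivity of the geometric mean gives, pointwise,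
`∑ T(f_i)^{1/d} ≤ ∑ ∏ (S_j f_{ij})^{1/d} ≤ ∏ (S_j h_j)^{1/d} ≤ B T(h)^{1/d}`, and one concludes
with Hölder's inequality and the norm bound on `T`. A general `h` is approximated by such tuples
`h'`, with every `f_i` lowered to `(f_i - |h - h'|)⁺`; the error is controlled by expanding `T`
multilinearly.

The components of `φ` give, for each `g ≥ 0` in `Y_j`, a finitely additive set function
`s ↦ φ(1_s g e_j)` vanishing on `μ`-null sets. Its countably additive part, the infimum of
`∑ m(s_n)` over countable covers, still depends additively on `g` (`countablyAdditivePart_add`)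
and still dominates, since a measure lying below `m` lies below its countably additive part. By
Radon–Nikodym its density is `R_j g ∈ L¹` (`exists_clm_countablyAdditivePart`).
-/

namespace MultilinearDuality

/-! ### Geometric means and lattice inequalities -/

lemma geomMean_le {d : ℕ} (hd : 1 ≤ d) (z : Fin d → ℝ) (hz : ∀ j, 0 ≤ z j) :
    (∏ j, z j) ^ (1 / (d : ℝ)) ≤ (1 / (d : ℝ)) * ∑ j, z j := by
  have hd' : (d : ℝ) ≠ 0 := by positivity
  have h := Real.geom_mean_le_arith_mean_weighted Finset.univ (fun _ : Fin d => 1 / (d : ℝ)) z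
    (fun _ _ => by positivity) (by simp [hd']) (fun j _ => hz j)
  rwa [← Finset.mul_sum, Real.finsetProd_rpow _ _ (fun j _ => hz j)] at h

/-- The geometric mean is superadditive on nonnegative tuples. -/
lemma sum_geomMean_le {ι : Type*} (s : Finset ι) {d : ℕ} (hd : 1 ≤ d) (a : ι → Fin d → ℝ)
    (ha : ∀ i ∈ s, ∀ j, 0 ≤ a i j) :
    ∑ i ∈ s, (∏ j, a i j) ^ (1 / (d : ℝ)) ≤ (∏ j, ∑ i ∈ s, a i j) ^ (1 / (d : ℝ)) := by
  have hd' : (d : ℝ) ≠ 0 := by positivity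
  have hb0 : ∀ j, 0 ≤ ∑ i ∈ s, a i j := fun j => Finset.sum_nonneg fun i hi => ha i hi j
  by_cases hb : ∃ j, ∑ i ∈ s, a i j = 0
  · obtain ⟨j, hj⟩ := hb
    rw [Finset.sum_eq_zero_iff_of_nonneg fun i hi => ha i hi j] at hj
    rw [Finset.sum_eq_zero]
    · exact Real.rpow_nonneg (Finset.prod_nonneg fun j _ => hb0 j) _
    · intro i hi
      rw [Finset.prod_eq_zero (Finset.mem_univ j) (hj i hi), Real.zero_rpow (by simpa using hd')]
  · push Not at hb
    have hbpos : ∀ j, 0 < ∑ i ∈ s, a i j := fun j => lt_of_le_of_ne (hb0 j) (hb j).symm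
    set P := (∏ j, ∑ i ∈ s, a i j) ^ (1 / (d : ℝ)) with hP
    have hP0 : 0 ≤ P := Real.rpow_nonneg (Finset.prod_nonneg fun j _ => hb0 j) _
    have key : ∀ i ∈ s, (∏ j, a i j) ^ (1 / (d : ℝ)) ≤
        P * ((1 / (d : ℝ)) * ∑ j, a i j / ∑ k ∈ s, a k j) := by
      intro i hi
      have h1 := geomMean_le hd (fun j => a i j / ∑ k ∈ s, a k j)
        (fun j => div_nonneg (ha i hi j) (hb0 j))
      have h2 : ∏ j, a i j = (∏ j, ∑ k ∈ s, a k j) * ∏ j, (a i j / ∑ k ∈ s, a k j) := by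
        rw [← Finset.prod_mul_distrib]
        exact Finset.prod_congr rfl fun j _ => (mul_div_cancel₀ _ (hb j)).symm
      rw [h2, Real.mul_rpow (Finset.prod_nonneg fun j _ => hb0 j)
        (Finset.prod_nonneg fun j _ => div_nonneg (ha i hi j) (hb0 j))]
      exact mul_le_mul_of_nonneg_left h1 hP0
    refine (Finset.sum_le_sum key).trans (le_of_eq ?_)
    rw [← Finset.mul_sum, ← Finset.mul_sum, Finset.sum_comm]
    simp_rw [← Finset.sum_div]
    rw [Finset.sum_congr rfl fun j _ => div_self (hb j)]
    simp [hd']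

lemma sum_rpow_le {ι : Type*} (s : Finset ι) (a : ι → ℝ) (ha : ∀ i ∈ s, 0 ≤ a i) {p : ℝ}
    (hp : 0 < p) (hp1 : p ≤ 1) : (∑ i ∈ s, a i) ^ p ≤ ∑ i ∈ s, a i ^ p := by
  classical
  induction s using Finset.induction_on with
  | empty => simp [Real.zero_rpow hp.ne']
  | insert i s hi ih =>
    rw [Finset.sum_insert hi, Finset.sum_insert hi]
    have h0 : ∀ k ∈ s, 0 ≤ a k := fun k hk => ha k (Finset.mem_insert_of_mem hk)
    exact (Real.rpow_add_le_add_rpow (ha i (Finset.mem_insert_self _ _))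
      (Finset.sum_nonneg h0) hp.le hp1).trans (by gcongr; exact ih h0)

/-- In `ℝ`: if some `f i` exceeds `e`, then lowering all summands by `e` and truncating at `0`
lowers the sum by at least `e`; otherwise the left side is `0`. -/
lemma sum_posPart_sub_le {W ι : Type*} [AddCommGroup W] [Lattice W] [IsOrderedAddMonoid W]
    (s : Finset ι) (f : ι → W) (hf : ∀ i ∈ s, 0 ≤ f i) {e : W} (he : 0 ≤ e) :
    ∑ i ∈ s, (f i - e)⁺ ≤ (∑ i ∈ s, f i - e)⁺ := by
  classical
  have two : ∀ a b : W, 0 ≤ a → 0 ≤ b → (a - e)⁺ + (b - e)⁺ ≤ (a + b - e)⁺ := by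
    intro a b ha hb
    have h : a + b - e ≤ (a + b - e)⁺ := le_posPart _
    rw [← le_sub_iff_add_le, posPart_def (a - e)]
    have hcomm : ∀ x y z : W, x + y ≤ z → y ≤ z - x := fun x y z h => by
      rw [le_sub_iff_add_le, add_comm]; exact h
    refine sup_le ?_ ?_
    · refine le_sub_comm.1 (sup_le ?_ ?_)
      · rw [le_sub_iff_add_le]
        refine le_trans ?_ h
        rw [show b - e + (a - e) = a + b - e - e by abel]
        exact sub_le_self _ he
      · rw [le_sub_iff_add_le, zero_add]
        exact le_trans (sub_le_sub_right (le_add_of_nonneg_right hb) e) h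
    · refine le_sub_comm.1 (sup_le ?_ ?_)
      · rw [sub_zero]
        exact le_trans (sub_le_sub_right (le_add_of_nonneg_left ha) e) h
      · rw [sub_zero]; exact posPart_nonneg _
  induction s using Finset.induction_on with
  | empty => simp
  | insert i s hi ih =>
    have h0 : ∀ k ∈ s, 0 ≤ f k := fun k hk => hf k (Finset.mem_insert_of_mem hk)
    rw [Finset.sum_insert hi, Finset.sum_insert hi]
    exact (add_le_add_right (ih h0) _).trans
      (two _ _ (hf i (Finset.mem_insert_self _ _)) (Finset.sum_nonneg h0))

/-- A map on the positive cone of a vector lattice that is additive and positively homogeneous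
extends to a linear map. -/
lemma exists_linearMap_of_cone {Z V : Type*} [AddCommGroup Z] [Module ℝ Z] [Lattice Z]
    [IsOrderedAddMonoid Z] [IsOrderedModule ℝ Z] [AddCommGroup V] [Module ℝ V] (r : Z → V)
    (hadd : ∀ a b, 0 ≤ a → 0 ≤ b → r (a + b) = r a + r b)
    (hsmul : ∀ (c : ℝ) a, 0 ≤ c → 0 ≤ a → r (c • a) = c • r a) :
    ∃ L : Z →ₗ[ℝ] V, (∀ a, 0 ≤ a → L a = r a) ∧ ∀ a, L a = r a⁺ - r a⁻ := by
  have hdiff : ∀ a p n : Z, 0 ≤ p → 0 ≤ n → a = p - n → r a⁺ - r a⁻ = r p - r n := by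
    intro a p n hp hn ha
    have h1 : a⁺ + n = p + a⁻ :=
      sub_eq_sub_iff_add_eq_add.1 ((posPart_sub_negPart a).trans ha)
    have h2 := congrArg r h1
    rw [hadd _ _ (posPart_nonneg a) hn, hadd _ _ hp (negPart_nonneg a)] at h2
    rw [sub_eq_sub_iff_add_eq_add, h2]
  refine ⟨{ toFun := fun a => r a⁺ - r a⁻, map_add' := ?_, map_smul' := ?_ }, ?_, fun a => rfl⟩
  · intro a b
    rw [hdiff (a + b) (a⁺ + b⁺) (a⁻ + b⁻) (add_nonneg (posPart_nonneg a) (posPart_nonneg b))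
      (add_nonneg (negPart_nonneg a) (negPart_nonneg b)),
      hadd _ _ (posPart_nonneg a) (posPart_nonneg b),
      hadd _ _ (negPart_nonneg a) (negPart_nonneg b)]
    · abel
    · conv_lhs => rw [← posPart_sub_negPart a, ← posPart_sub_negPart b]
      abel
  · intro c a
    rcases le_total 0 c with hc | hc
    · rw [hdiff (c • a) (c • a⁺) (c • a⁻) (smul_nonneg hc (posPart_nonneg a))
        (smul_nonneg hc (negPart_nonneg a)), hsmul _ _ hc (posPart_nonneg a),
        hsmul _ _ hc (negPart_nonneg a), RingHom.id_apply, smul_sub]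
      rw [← smul_sub, posPart_sub_negPart]
    · have hc' : 0 ≤ -c := neg_nonneg.2 hc
      rw [hdiff (c • a) ((-c) • a⁻) ((-c) • a⁺) (smul_nonneg hc' (negPart_nonneg a))
        (smul_nonneg hc' (posPart_nonneg a)), hsmul _ _ hc' (posPart_nonneg a),
        hsmul _ _ hc' (negPart_nonneg a), RingHom.id_apply, smul_sub, neg_smul, neg_smul]
      · abel
      · conv_lhs => rw [← posPart_sub_negPart a]
        rw [neg_smul, neg_smul, smul_sub]; abel
  · intro a ha
    have h0 : r 0 = 0 := by simpa using hsmul 0 0 le_rfl le_rfl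
    simp [posPart_eq_self.2 ha, negPart_eq_zero.2 ha, h0]

/-! ### The countably additive part of a finitely additive set function -/

/-- Finite additivity of a set function on the measurable sets; its values on other sets are
irrelevant. -/
structure IsFinitelyAdditive {X : Type*} [MeasurableSpace X] (m : Set X → ℝ≥0∞) : Prop where
  empty : m ∅ = 0
  union : ∀ s t, MeasurableSet s → MeasurableSet t → Disjoint s t → m (s ∪ t) = m s + m t

section

variable {X : Type*} [MeasurableSpace X]

open Classical in
/-- The set function `m` on measurable sets, and `∞` on all other sets. -/
noncomputable def extendTop (m : Set X → ℝ≥0∞) (s : Set X) : ℝ≥0∞ :=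
  if MeasurableSet s then m s else ∞

lemma extendTop_of_measurableSet (m : Set X → ℝ≥0∞) {s : Set X} (hs : MeasurableSet s) :
    extendTop m s = m s := if_pos hs

lemma extendTop_empty {m : Set X → ℝ≥0∞} (hm : IsFinitelyAdditive m) : extendTop m ∅ = 0 := by
  rw [extendTop_of_measurableSet m .empty, hm.empty]

/-- The countably additive part of `m`: the largest measure below `m`, obtained by minimising
`∑ m (tₙ)` over countable measurable covers. -/
noncomputable def countablyAdditivePart (m : Set X → ℝ≥0∞) (hm : IsFinitelyAdditive m) :
    Measure X :=
  (OuterMeasure.ofFunction (extendTop m) (extendTop_empty hm)).toMeasure <| by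
    intro s hs
    refine OuterMeasure.ofFunction_caratheodory fun t => ?_
    by_cases ht : MeasurableSet t
    · rw [extendTop_of_measurableSet m ht, extendTop_of_measurableSet m (ht.inter hs),
        extendTop_of_measurableSet m (ht.diff hs), ← hm.union _ _ (ht.inter hs) (ht.diff hs)
          (Set.disjoint_sdiff_right.mono_left Set.inter_subset_right), Set.inter_union_sdiff]
    · simp [extendTop, ht]

lemma countablyAdditivePart_apply {m : Set X → ℝ≥0∞} (hm : IsFinitelyAdditive m) {s : Set X}
    (hs : MeasurableSet s) : countablyAdditivePart m hm s =
      OuterMeasure.ofFunction (extendTop m) (extendTop_empty hm) s :=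
  toMeasure_apply _ _ hs

lemma countablyAdditivePart_le {m : Set X → ℝ≥0∞} (hm : IsFinitelyAdditive m) {s : Set X}
    (hs : MeasurableSet s) : countablyAdditivePart m hm s ≤ m s := by
  rw [countablyAdditivePart_apply hm hs, ← extendTop_of_measurableSet m hs]
  exact OuterMeasure.ofFunction_le s

lemma le_countablyAdditivePart {m : Set X → ℝ≥0∞} (hm : IsFinitelyAdditive m) (κ : Measure X)
    (h : ∀ s, MeasurableSet s → κ s ≤ m s) : κ ≤ countablyAdditivePart m hm := by
  refine Measure.le_iff.2 fun s hs => ?_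
  rw [countablyAdditivePart_apply hm hs, ← Measure.toOuterMeasure_apply]
  refine OuterMeasure.le_ofFunction.2 (fun t => ?_) s
  by_cases ht : MeasurableSet t
  · rw [extendTop_of_measurableSet m ht]; exact h t ht
  · simp [extendTop, ht]

lemma IsFinitelyAdditive.mono {m : Set X → ℝ≥0∞} (hm : IsFinitelyAdditive m) {s t : Set X}
    (hs : MeasurableSet s) (ht : MeasurableSet t) (hst : s ⊆ t) : m s ≤ m t := by
  rw [← Set.union_sdiff_cancel hst, hm.union s _ hs (ht.diff hs) Set.disjoint_sdiff_right]
  exact le_self_add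

lemma IsFinitelyAdditive.tsum_le {m : Set X → ℝ≥0∞} (hm : IsFinitelyAdditive m)
    {t : ℕ → Set X} (ht : ∀ n, MeasurableSet (t n)) (hd : Pairwise (Function.onFun Disjoint t))
    {s : Set X} (hs : MeasurableSet s) (hts : ∀ n, t n ⊆ s) : ∑' n, m (t n) ≤ m s := by
  rw [ENNReal.tsum_eq_iSup_nat]
  refine iSup_le fun n => ?_
  have hsum : m (⋃ i ∈ Finset.range n, t i) = ∑ i ∈ Finset.range n, m (t i) := by
    induction n with
    | zero => simp [hm.empty]
    | succ n ih =>
      rw [Finset.sum_range_succ, Finset.range_add_one, Finset.set_biUnion_insert, Set.union_comm,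
        hm.union _ _ (Finset.measurableSet_biUnion _ fun i _ => ht i) (ht n), ih]
      rw [Set.disjoint_iUnion₂_left]
      exact fun i hi => hd (Finset.mem_range.1 hi).ne
  rw [← hsum]
  exact hm.mono (Finset.measurableSet_biUnion _ fun i _ => ht i) hs
    (Set.iUnion₂_subset fun i _ => hts i)

/-- Taking countably additive parts is additive: two countable covers have a common disjoint
refinement. -/
lemma countablyAdditivePart_add {m m₁ m₂ : Set X → ℝ≥0∞} (hm : IsFinitelyAdditive m)
    (h₁ : IsFinitelyAdditive m₁) (h₂ : IsFinitelyAdditive m₂)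
    (h : ∀ s, MeasurableSet s → m s = m₁ s + m₂ s) :
    countablyAdditivePart m hm = countablyAdditivePart m₁ h₁ + countablyAdditivePart m₂ h₂ := by
  apply le_antisymm
  · refine Measure.le_iff.2 fun s hs => ?_
    rw [Measure.add_apply, countablyAdditivePart_apply h₁ hs, countablyAdditivePart_apply h₂ hs,
      OuterMeasure.ofFunction_eq_iInf_mem (m := extendTop m₁) _ (fun s hs => if_neg hs),
      OuterMeasure.ofFunction_eq_iInf_mem (m := extendTop m₂) _ (fun s hs => if_neg hs)]
    simp only [ENNReal.iInf_add, ENNReal.add_iInf, le_iInf_iff]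
    intro u hu hsu t ht hst
    have htd := MeasurableSet.disjointed ht
    have hud := MeasurableSet.disjointed hu
    have hcover : s ⊆ ⋃ p, ⋃ q, disjointed t p ∩ disjointed u q := by
      intro x hx
      have h1 := hst hx
      have h2 := hsu hx
      rw [← iUnion_disjointed] at h1 h2
      simp only [Set.mem_iUnion] at h1 h2 ⊢
      obtain ⟨p, hp⟩ := h1
      obtain ⟨q, hq⟩ := h2
      exact ⟨p, q, hp, hq⟩
    calc countablyAdditivePart m hm s
        ≤ ∑' p, ∑' q, countablyAdditivePart m hm (disjointed t p ∩ disjointed u q) :=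
          (measure_mono hcover).trans ((measure_iUnion_le _).trans
            (ENNReal.tsum_le_tsum fun p => measure_iUnion_le _))
      _ ≤ ∑' p, ∑' q, (m₁ (disjointed t p ∩ disjointed u q)
            + m₂ (disjointed t p ∩ disjointed u q)) :=
          ENNReal.tsum_le_tsum fun p => ENNReal.tsum_le_tsum fun q =>
            (countablyAdditivePart_le hm ((htd p).inter (hud q))).trans
              (h _ ((htd p).inter (hud q))).le
      _ = ∑' p, ∑' q, m₁ (disjointed t p ∩ disjointed u q)
            + ∑' q, ∑' p, m₂ (disjointed t p ∩ disjointed u q) := by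
          simp_rw [ENNReal.tsum_add]
          congr 1
          exact ENNReal.tsum_comm
      _ ≤ ∑' p, extendTop m₁ (t p) + ∑' q, extendTop m₂ (u q) := by
          gcongr with p q
          · rw [extendTop_of_measurableSet _ (ht p)]
            exact h₁.tsum_le (fun q => (htd p).inter (hud q))
              (fun a b hab => ((disjoint_disjointed u) hab).mono Set.inter_subset_right
                Set.inter_subset_right) (ht p)
              (fun q => Set.inter_subset_left.trans (disjointed_subset t p))
          · rw [extendTop_of_measurableSet _ (hu q)]
            exact h₂.tsum_le (fun p => (htd p).inter (hud q))
              (fun a b hab => ((disjoint_disjointed t) hab).mono Set.inter_subset_left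
                Set.inter_subset_left) (hu q)
              (fun p => Set.inter_subset_right.trans (disjointed_subset u q))
  · refine le_countablyAdditivePart hm _ fun s hs => ?_
    rw [Measure.add_apply, h s hs]
    exact add_le_add (countablyAdditivePart_le h₁ hs) (countablyAdditivePart_le h₂ hs)

lemma IsFinitelyAdditive.finsetSum {ι : Type*} (s : Finset ι) {m : ι → Set X → ℝ≥0∞}
    (h : ∀ i, IsFinitelyAdditive (m i)) : IsFinitelyAdditive (∑ i ∈ s, m i) where
  empty := by simp [Finset.sum_apply, (h _).empty]
  union a b ha hb hab := by
    simp only [Finset.sum_apply, (h _).union a b ha hb hab, Finset.sum_add_distrib]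

lemma countablyAdditivePart_finsetSum {ι : Type*} (s : Finset ι) {m : ι → Set X → ℝ≥0∞}
    (h : ∀ i, IsFinitelyAdditive (m i)) :
    countablyAdditivePart (∑ i ∈ s, m i) (.finsetSum s h) =
      ∑ i ∈ s, countablyAdditivePart (m i) (h i) := by
  classical
  induction s using Finset.induction_on with
  | empty =>
    refine le_antisymm (Measure.le_iff.2 fun a ha => ?_) (by simpa using Measure.zero_le _)
    simpa using countablyAdditivePart_le (.finsetSum ∅ h) ha
  | insert i s hi ih =>
    rw [Finset.sum_insert (f := fun i => countablyAdditivePart (m i) (h i)) hi, ← ih]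
    exact countablyAdditivePart_add _ _ _ fun a _ => by rw [Finset.sum_insert hi]; rfl

lemma countablyAdditivePart_smul {m m' : Set X → ℝ≥0∞} (hm : IsFinitelyAdditive m)
    (hm' : IsFinitelyAdditive m') (c : ℝ≥0) (h : ∀ s, MeasurableSet s → m' s = c * m s) :
    countablyAdditivePart m' hm' = c • countablyAdditivePart m hm := by
  apply le_antisymm
  · rcases eq_or_ne c 0 with rfl | hc
    · refine Measure.le_iff.2 fun s hs => ?_
      simpa [h s hs] using countablyAdditivePart_le hm' hs
    · have h1 : c⁻¹ • countablyAdditivePart m' hm' ≤ countablyAdditivePart m hm := by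
        refine le_countablyAdditivePart hm _ fun s hs => ?_
        rw [Measure.smul_apply, ENNReal.smul_def, smul_eq_mul, ENNReal.coe_inv hc,
          mul_comm, ← div_eq_mul_inv]
        refine ENNReal.div_le_of_le_mul ?_
        rw [mul_comm, ← h s hs]
        exact countablyAdditivePart_le hm' hs
      refine Measure.le_iff.2 fun s hs => ?_
      have h2 := Measure.le_iff.1 h1 s hs
      rw [Measure.smul_apply, ENNReal.smul_def, smul_eq_mul, ENNReal.coe_inv hc,
        mul_comm, ← div_eq_mul_inv] at h2
      rw [Measure.smul_apply, ENNReal.smul_def, smul_eq_mul, mul_comm]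
      exact (ENNReal.div_le_iff_le_mul (by simp [hc]) (by simp)).1 h2
  · refine le_countablyAdditivePart hm' _ fun s hs => ?_
    rw [h s hs, Measure.smul_apply, ENNReal.smul_def, smul_eq_mul]
    gcongr
    exact countablyAdditivePart_le hm hs

end

/-! ### From finitely additive set functions to operators into `L¹` -/

/-- A linear map `ν` into the finitely additive set functions which is positive, absolutely
continuous and bounded yields an operator into `L¹` whose values on the positive cone are the
densities of the countably additive parts. -/
lemma exists_clm_countablyAdditivePart {X : Type*} [MeasurableSpace X] (μ : Measure X)
    [SigmaFinite μ] {Z : Type*} [NormedAddCommGroup Z] [NormedSpace ℝ Z] [Lattice Z]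
    [IsOrderedAddMonoid Z] [IsOrderedModule ℝ Z] [HasSolidNorm Z] (ν : Z →ₗ[ℝ] Set X → ℝ)
    (hpos : ∀ g s, 0 ≤ g → MeasurableSet s → 0 ≤ ν g s)
    (hfa : ∀ g, 0 ≤ g → IsFinitelyAdditive fun s => ENNReal.ofReal (ν g s))
    (hnull : ∀ g s, 0 ≤ g → MeasurableSet s → μ s = 0 → ν g s ≤ 0)
    (C : ℝ≥0) (hC : ∀ g, 0 ≤ g → ν g Set.univ ≤ C * ‖g‖) :
    ∃ R : Z →L[ℝ] Lp ℝ 1 μ, ‖R‖ ≤ C ∧ (∀ g, 0 ≤ g → ∀ᵐ x ∂μ, 0 ≤ R g x) ∧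
      ∀ g (hg : 0 ≤ g) s, MeasurableSet s →
        ∫⁻ x in s, ENNReal.ofReal (R g x) ∂μ = countablyAdditivePart _ (hfa g hg) s := by
  have hgp : ∀ g : Z, 0 ≤ g⁺ := fun g => posPart_nonneg g
  let N : Z → Measure X := fun g => countablyAdditivePart _ (hfa g⁺ (hgp g))
  have hN : ∀ g (hg : 0 ≤ g), N g = countablyAdditivePart _ (hfa g hg) := fun g hg => by
    simp only [N, posPart_eq_self.2 hg]
  have hNuniv : ∀ g, 0 ≤ g → N g Set.univ ≤ ENNReal.ofReal (C * ‖g‖) := fun g hg => by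
    rw [hN g hg]
    exact (countablyAdditivePart_le _ .univ).trans (ENNReal.ofReal_le_ofReal (hC g hg))
  have hfin : ∀ g, IsFiniteMeasure (N g) := fun g =>
    ⟨(countablyAdditivePart_le _ .univ).trans_lt ENNReal.ofReal_lt_top⟩
  have hac : ∀ g, N g ≪ μ := fun g => by
    refine Measure.AbsolutelyContinuous.mk fun s hs h0 => le_antisymm ?_ zero_le
    refine (countablyAdditivePart_le _ hs).trans ?_
    simpa using hnull _ s (hgp g) hs h0
  have hNadd : ∀ a b, 0 ≤ a → 0 ≤ b → N (a + b) = N a + N b := fun a b ha hb => by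
    rw [hN a ha, hN b hb, hN _ (add_nonneg ha hb)]
    refine countablyAdditivePart_add _ _ _ fun s hs => ?_
    rw [map_add, Pi.add_apply, ENNReal.ofReal_add (hpos a s ha hs) (hpos b s hb hs)]
  have hNsmul : ∀ (c : ℝ≥0) a, 0 ≤ a → N ((c : ℝ) • a) = c • N a := fun c a ha => by
    rw [hN a ha, hN _ (smul_nonneg c.coe_nonneg ha)]
    refine countablyAdditivePart_smul _ _ c fun s hs => ?_
    rw [map_smul, Pi.smul_apply, smul_eq_mul, ENNReal.ofReal_mul c.coe_nonneg,
      ENNReal.ofReal_coe_nnreal]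
  have hint : ∀ g, Integrable (fun x => ((N g).rnDeriv μ x).toReal) μ := fun g =>
    Measure.integrable_toReal_rnDeriv
  let r : Z → Lp ℝ 1 μ := fun g => (hint g).toL1 _
  have hr : ∀ g, r g =ᵐ[μ] fun x => ((N g).rnDeriv μ x).toReal := fun g => (hint g).coeFn_toL1
  have hradd : ∀ a b, 0 ≤ a → 0 ≤ b → r (a + b) = r a + r b := fun a b ha hb => by
    apply Lp.ext
    have := Measure.rnDeriv_add (N a) (N b) μ
    rw [← hNadd a b ha hb] at this
    filter_upwards [hr a, hr b, hr (a + b), this, Lp.coeFn_add (r a) (r b),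
      (N a).rnDeriv_lt_top μ, (N b).rnDeriv_lt_top μ] with x h1 h2 h3 h4 h5 h6 h7
    rw [h5, Pi.add_apply, h1, h2, h3, h4, Pi.add_apply, ENNReal.toReal_add h6.ne h7.ne]
  have hrsmul : ∀ (c : ℝ) a, 0 ≤ c → 0 ≤ a → r (c • a) = c • r a := fun c a hc ha => by
    lift c to ℝ≥0 using hc
    apply Lp.ext
    have := Measure.rnDeriv_smul_left (N a) μ c
    rw [← hNsmul c a ha] at this
    filter_upwards [hr a, hr ((c : ℝ) • a), this, Lp.coeFn_smul (c : ℝ) (r a)] with x h1 h2 h3 h4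
    rw [h4, Pi.smul_apply, h1, h2, h3, Pi.smul_apply, ENNReal.smul_def, smul_eq_mul,
      ENNReal.toReal_mul, ENNReal.coe_toReal, smul_eq_mul]
  have hrnonneg : ∀ g, ∀ᵐ x ∂μ, 0 ≤ r g x := fun g => by
    filter_upwards [hr g] with x hx
    rw [hx]; exact ENNReal.toReal_nonneg
  have hset : ∀ g s, MeasurableSet s → ∫⁻ x in s, ENNReal.ofReal (r g x) ∂μ = N g s := by
    intro g s hs
    rw [← Measure.setLIntegral_rnDeriv (hac g) s]
    refine lintegral_congr_ae (ae_restrict_of_ae ?_)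
    filter_upwards [hr g, (N g).rnDeriv_lt_top μ] with x h1 h2
    rw [h1, ENNReal.ofReal_toReal h2.ne]
  have hnorm : ∀ g, 0 ≤ g → ‖r g‖ = (N g Set.univ).toReal := fun g hg => by
    rw [← hset g _ .univ, Measure.restrict_univ, L1.norm_def]
    congr 1
    refine lintegral_congr_ae ?_
    filter_upwards [hrnonneg g] with x hx
    rw [← ofReal_norm, Real.norm_of_nonneg hx]
  obtain ⟨L, hL, hL'⟩ := exists_linearMap_of_cone r hradd hrsmul
  refine ⟨L.mkContinuous C fun g => ?_, L.mkContinuous_norm_le C.coe_nonneg _, fun g hg => ?_,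
    fun g hg s hs => ?_⟩
  · have habs : N |g| = N g⁺ + N g⁻ := by
      rw [← posPart_add_negPart, hNadd _ _ (hgp g) (negPart_nonneg g)]
    have := hfin g⁺
    have := hfin g⁻
    calc ‖L g‖ ≤ ‖r g⁺‖ + ‖r g⁻‖ := by rw [hL']; exact norm_sub_le _ _
      _ = (N |g| Set.univ).toReal := by
        rw [hnorm _ (hgp g), hnorm _ (negPart_nonneg g), habs, Measure.add_apply,
          ENNReal.toReal_add (measure_ne_top _ _) (measure_ne_top _ _)]
      _ ≤ C * ‖|g|‖ := ENNReal.toReal_le_of_le_ofReal (by positivity) (hNuniv _ (abs_nonneg g))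
      _ = C * ‖g‖ := by rw [norm_abs_eq_norm]
  · rw [LinearMap.mkContinuous_apply, hL g hg]
    exact hrnonneg g
  · rw [LinearMap.mkContinuous_apply, hL g hg, hset g s hs, hN g hg]

/-! ### A separation theorem for vector-valued simple functions -/

/-- The M. Riesz extension theorem in the form used below. If `∑ᵢ Λ (fᵢ, Eᵢ) ≤ p h` whenever
`∑ᵢ 1_{Eᵢ} fᵢ ≤ h` a.e., then some linear functional on the `W`-valued simple functions, positive
for the a.e. order, lies above `Λ` on the functions `1_E f` and below `p` on constants. -/
lemma exists_separating_functional {X : Type*} [MeasurableSpace X] (μ : Measure X) {W : Type*}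
    [AddCommGroup W] [Module ℝ W] [Lattice W] [IsOrderedAddMonoid W] [PosSMulMono ℝ W]
    (Λ : W → Set X → ℝ) (p : W → ℝ)
    (hΛ : ∀ (c : ℝ) f s, 0 ≤ c → 0 ≤ f → Λ (c • f) s = c * Λ f s)
    (hp_add : ∀ a b, 0 ≤ a → 0 ≤ b → p (a + b) ≤ p a + p b)
    (hp_smul : ∀ (c : ℝ) a, 0 ≤ c → 0 ≤ a → p (c • a) = c * p a)
    (hkey : ∀ (n : ℕ) (f : Fin n → W) (E : Fin n → Set X) (h : W), (∀ i, 0 ≤ f i) →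
      (∀ i, MeasurableSet (E i)) → 0 ≤ h →
      (∀ᵐ x ∂μ, ∑ i, (E i).indicator (fun _ => f i) x ≤ h) → ∑ i, Λ (f i) (E i) ≤ p h) :
    ∃ φ : SimpleFunc X W →ₗ[ℝ] ℝ, (∀ G, (∀ᵐ x ∂μ, G x ≤ 0) → φ G ≤ 0) ∧
      (∀ h, 0 ≤ h → φ (SimpleFunc.const X h) ≤ p h) ∧
      ∀ f s, 0 ≤ f → MeasurableSet s → Λ f s ≤ φ ((SimpleFunc.const X f).restrict s) := by
  have hp0 : p 0 = 0 := by simpa using hp_smul 0 0 le_rfl le_rfl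
  -- The cone of all pairs `(G, c)` for which the requirements force `φ G ≤ c`.
  let K : PointedCone ℝ (SimpleFunc X W × ℝ) :=
    { carrier := {y | ∃ (n : ℕ) (f : Fin n → W) (E : Fin n → Set X) (h : W), (∀ i, 0 ≤ f i) ∧
        (∀ i, MeasurableSet (E i)) ∧ 0 ≤ h ∧
        (∀ᵐ x ∂μ, y.1 x + ∑ i, (E i).indicator (fun _ => f i) x ≤ h) ∧
        p h - ∑ i, Λ (f i) (E i) ≤ y.2}
      zero_mem' := ⟨0, Fin.elim0, Fin.elim0, 0, fun i => i.elim0, fun i => i.elim0, le_rfl,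
        by simp, by simp [hp0]⟩
      add_mem' := by
        rintro y z ⟨n, f, E, h, hf, hE, hh, hle, hc⟩ ⟨n', f', E', h', hf', hE', hh', hle', hc'⟩
        refine ⟨n + n', Fin.append f f', Fin.append E E', h + h', ?_, ?_, add_nonneg hh hh', ?_,
          ?_⟩
        · exact Fin.addCases (by simpa using hf) (by simpa using hf')
        · exact Fin.addCases (by simpa using hE) (by simpa using hE')
        · filter_upwards [hle, hle'] with x h1 h2
          simp only [Fin.sum_univ_add, Fin.append_left, Fin.append_right, Prod.fst_add,
            SimpleFunc.coe_add, Pi.add_apply]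
          rw [add_add_add_comm]
          exact add_le_add h1 h2
        · simp only [Fin.sum_univ_add, Fin.append_left, Fin.append_right, Prod.snd_add]
          linarith [hp_add h h' hh hh']
      smul_mem' := by
        rintro ⟨c, hc0⟩ y ⟨n, f, E, h, hf, hE, hh, hle, hc⟩
        refine ⟨n, fun i => c • f i, E, c • h, fun i => smul_nonneg hc0 (hf i), hE,
          smul_nonneg hc0 hh, ?_, ?_⟩
        · filter_upwards [hle] with x h1
          have h2 := smul_le_smul_of_nonneg_left h1 hc0
          rw [smul_add, Finset.smul_sum] at h2
          refine le_trans (le_of_eq ?_) h2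
          congr 1
          refine Finset.sum_congr rfl fun i _ => ?_
          by_cases hx : x ∈ E i <;> simp [hx]
        · rw [hp_smul c h hc0 hh, Finset.sum_congr rfl fun i _ => hΛ c (f i) (E i) hc0 (hf i),
            ← Finset.mul_sum, ← mul_sub]
          exact mul_le_mul_of_nonneg_left hc hc0 }
  have hK : ∀ y : SimpleFunc X W × ℝ, y ∈ K ↔ ∃ (n : ℕ) (f : Fin n → W) (E : Fin n → Set X)
      (h : W), (∀ i, 0 ≤ f i) ∧ (∀ i, MeasurableSet (E i)) ∧ 0 ≤ h ∧
        (∀ᵐ x ∂μ, y.1 x + ∑ i, (E i).indicator (fun _ => f i) x ≤ h) ∧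
        p h - ∑ i, Λ (f i) (E i) ≤ y.2 := fun y => Iff.rfl
  let F : (SimpleFunc X W × ℝ) →ₗ.[ℝ] ℝ :=
    ⟨Submodule.prod ⊥ ⊤, (LinearMap.snd ℝ (SimpleFunc X W) ℝ).domRestrict _⟩
  have hF : ∀ y : F.domain, F y = (y : SimpleFunc X W × ℝ).2 := fun y => rfl
  obtain ⟨g, hgF, hgK⟩ := riesz_extension K F (by
      rintro ⟨⟨G, c⟩, hG⟩ hmem
      obtain ⟨hG0, -⟩ := Submodule.mem_prod.1 hG
      obtain rfl : G = 0 := by simpa using hG0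
      obtain ⟨n, f, E, h, hf, hE, hh, hle, hc⟩ := (hK _).1 hmem
      rw [hF]
      have := hkey n f E h hf hE hh (by simpa using hle)
      simp only at hc ⊢
      linarith) (by
      rintro ⟨G, c⟩
      -- A simple function is bounded by the sum of the absolute values it takes.
      set h := ∑ y ∈ G.range, |y| with hh
      have hh0 : 0 ≤ h := Finset.sum_nonneg fun y _ => abs_nonneg y
      refine ⟨⟨(0, p h - c), by simp [F]⟩, (hK _).2
        ⟨0, Fin.elim0, Fin.elim0, h, fun i => i.elim0, fun i => i.elim0, hh0, ?_, ?_⟩⟩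
      · refine .of_forall fun x => ?_
        simp only [Prod.mk_add_mk, zero_add, Finset.univ_eq_empty, Finset.sum_empty, add_zero]
        exact (le_abs_self _).trans (Finset.single_le_sum (f := fun y => |y|)
          (fun y _ => abs_nonneg y) (SimpleFunc.mem_range_self G x))
      · simp)
  have hg2 : ∀ c : ℝ, g (0, c) = c := fun c => by
    have := hgF ⟨(0, c), by simp [F]⟩
    rwa [hF] at this
  have hg : ∀ G c, (G, c) ∈ K → -g (G, 0) ≤ c := fun G c h => by
    have h1 := hgK _ h
    rw [show (G, c) = (G, (0 : ℝ)) + (0, c) by simp, map_add, hg2] at h1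
    linarith
  refine ⟨-(g ∘ₗ LinearMap.inl ℝ _ _), fun G hG => ?_, fun h hh => ?_, fun f s hf hs => ?_⟩
  · refine hg G 0 ((hK _).2 ⟨0, Fin.elim0, Fin.elim0, 0, fun i => i.elim0, fun i => i.elim0,
      le_rfl, ?_, by simp [hp0]⟩)
    simpa using hG
  · exact hg _ _ ((hK _).2 ⟨0, Fin.elim0, Fin.elim0, h, fun i => i.elim0, fun i => i.elim0,
      hh, by simp, by simp⟩)
  · have h1 := hg (-(SimpleFunc.const X f).restrict s) (-Λ f s) ((hK _).2
      ⟨1, fun _ => f, fun _ => s, 0, fun _ => hf, fun _ => hs, le_rfl, .of_forall fun x => ?_,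
        by simp [hp0]⟩)
    · rw [show (-(SimpleFunc.const X f).restrict s, (0 : ℝ)) =
        -((SimpleFunc.const X f).restrict s, (0 : ℝ)) by simp, map_neg] at h1
      simp only [LinearMap.neg_apply, LinearMap.comp_apply, LinearMap.inl_apply]
      linarith
    · simp only [SimpleFunc.coe_neg, Pi.neg_apply, SimpleFunc.restrict_apply _ hs,
        Fin.sum_univ_one]
      exact le_of_eq (neg_add_cancel _)

/-! ### The weighted root of a multilinear operator -/

lemma prod_norm_piecewise_le {d : ℕ} {Y : Fin d → Type*}
    [∀ j, NormedAddCommGroup (Y j)] {g r f : ∀ j, Y j} {ε : ℝ}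
    (hε : 0 ≤ ε) (hε1 : ε ≤ 1)
    (hg : ∀ j, ‖g j‖ ≤ ‖f j‖) (hr : ∀ j, ‖r j‖ ≤ ε) {t : Finset (Fin d)} [∀ j, Decidable (j ∈ t)]
    (ht : t ≠ Finset.univ) : ∏ j, ‖t.piecewise g r j‖ ≤ ε * ∏ j, (‖f j‖ + 1) := by
  obtain ⟨j, hj⟩ : ∃ j, j ∉ t := by
    by_contra! h
    exact ht (Finset.eq_univ_iff_forall.2 h)
  have h1 : ∀ k, 1 ≤ ‖f k‖ + 1 := fun k => by linarith [norm_nonneg (f k)]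
  rw [← Finset.mul_prod_erase _ _ (Finset.mem_univ j), ← Finset.mul_prod_erase Finset.univ
    (fun j => ‖f j‖ + 1) (Finset.mem_univ j), ← mul_assoc]
  refine mul_le_mul ?_ (Finset.prod_le_prod (fun k _ => norm_nonneg _) fun k _ => ?_)
    (Finset.prod_nonneg fun k _ => norm_nonneg _) (by positivity)
  · rw [Finset.piecewise_eq_of_notMem _ _ _ hj]
    exact (hr j).trans (le_mul_of_one_le_right hε (h1 j))
  · by_cases hk : k ∈ t
    · rw [Finset.piecewise_eq_of_mem _ _ _ hk]; linarith [hg k]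
    · rw [Finset.piecewise_eq_of_notMem _ _ _ hk]; linarith [hr k, norm_nonneg (f k)]

section

variable {X : Type*} [MeasurableSpace X] {μ : Measure X} {d : ℕ} {Y : Fin d → Type*}
  [∀ j, NormedAddCommGroup (Y j)] [∀ j, NormedSpace ℝ (Y j)]

lemma ae_coeFn_finsetSum {ι : Type*} (s : Finset ι) (F : ι → X →ₘ[μ] ℝ) :
    ∀ᵐ x ∂μ, (∑ i ∈ s, F i : X →ₘ[μ] ℝ) x = ∑ i ∈ s, F i x := by
  classical
  induction s using Finset.induction_on with
  | empty => simpa using! AEEqFun.coeFn_zero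
  | insert i s hi ih =>
    simp only [Finset.sum_insert hi]
    filter_upwards [ih, AEEqFun.coeFn_add (F i) (∑ k ∈ s, F k)] with x h1 h2
    rw [h2, Pi.add_apply, h1]

/-- The density `M · T(f)^{1/d}`, as a function with values in `[0, ∞]`. -/
noncomputable def weightedRoot (T : MultilinearMap ℝ Y (X →ₘ[μ] ℝ)) (M : X → ℝ) (f : ∀ j, Y j)
    (x : X) : ℝ≥0∞ :=
  ENNReal.ofReal (M x * (T f x) ^ (1 / (d : ℝ)))

variable (T : MultilinearMap ℝ Y (X →ₘ[μ] ℝ)) {M : X → ℝ}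

lemma aemeasurable_weightedRoot (hM : AEStronglyMeasurable M μ) (f : ∀ j, Y j) :
    AEMeasurable (weightedRoot T M f) μ :=
  (hM.aemeasurable.mul ((T f).aestronglyMeasurable.aemeasurable.pow_const _)).ennreal_ofReal

end

section

variable {X : Type*} [MeasurableSpace X] {μ : Measure X} {d : ℕ} {Y : Fin d → Type*}
  [∀ j, NormedAddCommGroup (Y j)] [∀ j, NormedSpace ℝ (Y j)] [∀ j, Lattice (Y j)]
  {T : MultilinearMap ℝ Y (X →ₘ[μ] ℝ)} {q q' : ℝ≥0∞} {A B : ℝ≥0}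

lemma lintegral_weightedRoot_le (hbound : NormBound T q A) (hqq' : ENNReal.HolderConjugate q q')
    (M : Lp ℝ q' μ) (hM1 : ‖M‖ = 1) {f : ∀ j, Y j} (hf : ∀ j, 0 ≤ f j) :
    ∫⁻ x, weightedRoot T M f x ∂μ ≤ ENNReal.ofReal (A * (∏ j, ‖f j‖) ^ (1 / (d : ℝ))) := by
  have : ENNReal.HolderTriple q' q 1 := ENNReal.HolderTriple.symm
  have hM : eLpNorm M q' μ = 1 := by
    rwa [Lp.norm_def, ENNReal.toReal_eq_one_iff] at hM1
  have hm : AEStronglyMeasurable (fun x => (T f x) ^ (1 / (d : ℝ))) μ :=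
    ((T f).aestronglyMeasurable.aemeasurable.pow_const _).aestronglyMeasurable
  calc ∫⁻ x, weightedRoot T M f x ∂μ
      ≤ ∫⁻ x, ‖((M : X → ℝ) • fun x => (T f x) ^ (1 / (d : ℝ))) x‖ₑ ∂μ :=
        lintegral_mono fun x => Real.ofReal_le_enorm _
    _ = eLpNorm ((M : X → ℝ) • fun x => (T f x) ^ (1 / (d : ℝ))) 1 μ :=
        eLpNorm_one_eq_lintegral_enorm.symm
    _ ≤ eLpNorm M q' μ * eLpNorm (fun x => (T f x) ^ (1 / (d : ℝ))) q μ :=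
        eLpNorm_smul_le_mul_eLpNorm hm (Lp.aestronglyMeasurable M)
    _ ≤ _ := by rw [hM, one_mul]; exact hbound f hf

lemma weightedRoot_smul (hd : 1 ≤ d) (hpos : IsPositive T) {M : X → ℝ} {c : ℝ} (hc : 0 ≤ c)
    {f : ∀ j, Y j} (hf : ∀ j, 0 ≤ f j) :
    ∀ᵐ x ∂μ, weightedRoot T M (c • f) x = ENNReal.ofReal c * weightedRoot T M f x := by
  have hd' : (d : ℝ) ≠ 0 := by positivity
  have hT : T (c • f) = (c ^ d) • T f := by
    have := T.map_smul_univ (fun _ => c) f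
    simpa using! this
  filter_upwards [hpos f hf, AEEqFun.coeFn_smul (c ^ d) (T f)] with x h0 h1
  simp only [weightedRoot]
  rw [hT, h1, Pi.smul_apply, smul_eq_mul, Real.mul_rpow (by positivity) h0, ← Real.rpow_natCast,
    ← Real.rpow_mul hc, mul_one_div_cancel hd', Real.rpow_one, ← ENNReal.ofReal_mul hc]
  congr 1
  ring

open Classical in
lemma setLIntegral_weightedRoot_add_le (hd : 1 ≤ d) (hpos : IsPositive T) {M : X → ℝ}
    (hMm : AEStronglyMeasurable M μ) (hM : ∀ᵐ x ∂μ, 0 ≤ M x) {g r : ∀ j, Y j}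
    (hg : ∀ j, 0 ≤ g j) (hr : ∀ j, 0 ≤ r j) (s : Set X) :
    ∫⁻ x in s, weightedRoot T M (g + r) x ∂μ ≤
      ∑ t : Finset (Fin d), ∫⁻ x in s, weightedRoot T M (t.piecewise g r) x ∂μ := by
  rw [← lintegral_finsetSum' _ fun t _ => (aemeasurable_weightedRoot T hMm _).restrict]
  refine lintegral_mono_ae (ae_restrict_of_ae ?_)
  have hp : ∀ (t : Finset (Fin d)) j, 0 ≤ t.piecewise g r j := fun t j => by
    by_cases h : j ∈ t <;> simp [h, hg, hr]
  filter_upwards [hM, ae_coeFn_finsetSum Finset.univ fun t : Finset (Fin d) => T (t.piecewise g r),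
    ae_all_iff.2 fun t : Finset (Fin d) => hpos _ (hp t)] with x h0 h1 h2
  simp only [weightedRoot]
  rw [T.map_add_univ, h1, ← ENNReal.ofReal_sum_of_nonneg
    fun t _ => mul_nonneg h0 (Real.rpow_nonneg (h2 t) _), ← Finset.mul_sum]
  refine ENNReal.ofReal_le_ofReal (mul_le_mul_of_nonneg_left ?_ h0)
  refine sum_rpow_le _ _ (fun t _ => h2 t) (by positivity) ?_
  rw [div_le_one (by positivity)]
  exact_mod_cast hd

/-- Perturbing a nonnegative tuple by a small one changes the integral of the weighted root only
slightly: expand `T (g + r)` multilinearly and use subadditivity of the root. -/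
lemma setLIntegral_weightedRoot_le_add (hd : 1 ≤ d)
    (hpos : IsPositive T)
    (hbound : NormBound T q A) (hqq' : ENNReal.HolderConjugate q q') (M : Lp ℝ q' μ)
    (hM : ∀ᵐ x ∂μ, 0 ≤ M x) (hM1 : ‖M‖ = 1) {g r f : ∀ j, Y j} (hg0 : ∀ j, 0 ≤ g j)
    (hr0 : ∀ j, 0 ≤ r j) {ε : ℝ} (hε : 0 ≤ ε) (hε1 : ε ≤ 1) (hg : ∀ j, ‖g j‖ ≤ ‖f j‖)
    (hr : ∀ j, ‖r j‖ ≤ ε) (s : Set X) :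
    ∫⁻ x in s, weightedRoot T M (g + r) x ∂μ ≤ ∫⁻ x in s, weightedRoot T M g x ∂μ +
      ENNReal.ofReal (2 ^ d * (A * (ε * ∏ j, (‖f j‖ + 1)) ^ (1 / (d : ℝ)))) := by
  classical
  refine (setLIntegral_weightedRoot_add_le hd hpos (Lp.aestronglyMeasurable M) hM hg0 hr0 s).trans
    ?_
  rw [← Finset.add_sum_erase _ _ (Finset.mem_univ (Finset.univ : Finset (Fin d)))]
  refine add_le_add (by simp) ?_
  refine (Finset.sum_le_card_nsmul _ _
    (ENNReal.ofReal (A * (ε * ∏ j, (‖f j‖ + 1)) ^ (1 / (d : ℝ)))) fun t ht => ?_).trans ?_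
  · have hp : ∀ j, 0 ≤ t.piecewise g r j := fun j => by
      by_cases h : j ∈ t <;> simp [h, hg0, hr0]
    refine (setLIntegral_le_lintegral _ _).trans
      ((lintegral_weightedRoot_le hbound hqq' M hM1 hp).trans (ENNReal.ofReal_le_ofReal ?_))
    gcongr
    exact prod_norm_piecewise_le hε hε1 hg hr (Finset.ne_of_mem_erase ht)
  · rw [← ENNReal.ofReal_nsmul, nsmul_eq_mul]
    refine ENNReal.ofReal_le_ofReal ?_
    gcongr
    have : ((Finset.univ : Finset (Finset (Fin d))).erase Finset.univ).card ≤ 2 ^ d := by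
      refine (Finset.card_erase_le).trans ?_
      simp
    exact_mod_cast this

/-! ### The key inequality -/

lemma ae_sum_le_of_sum_le {Z : Type*} [AddCommGroup Z] [Module ℝ Z] [Lattice Z]
    [IsOrderedAddMonoid Z] (S : Z →ₗ[ℝ] X →ₘ[μ] ℝ) (hS : ∀ g, 0 ≤ g → ∀ᵐ x ∂μ, 0 ≤ S g x)
    {n : ℕ} (f : Fin n → Z) (s : Finset (Fin n)) {h : Z} (hle : ∑ i ∈ s, f i ≤ h) :
    ∀ᵐ x ∂μ, ∑ i ∈ s, S (f i) x ≤ S h x := by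
  have h1 := hS _ (sub_nonneg.2 hle)
  rw [map_sub, map_sum] at h1
  filter_upwards [h1, AEEqFun.coeFn_sub (S h) (∑ i ∈ s, S (f i)),
    ae_coeFn_finsetSum s fun i => S (f i)] with x h2 h3 h4
  rw [h3, Pi.sub_apply, h4] at h2
  linarith

variable [∀ j, IsOrderedAddMonoid (Y j)]

/-- The key inequality for a tuple `h` that admits dominating operators `S`: superadditivity
of the geometric mean passes from the `fᵢ` to `h` at the level of the `S j`. -/
lemma sum_setLIntegral_weightedRoot_le_of_dominated (hd : 1 ≤ d) (hpos : IsPositive T) {M : X → ℝ}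
    (hMm : AEStronglyMeasurable M μ) (hM : ∀ᵐ x ∂μ, 0 ≤ M x) {n : ℕ} {f : Fin n → ∀ j, Y j}
    {E : Fin n → Set X} {h : ∀ j, Y j} (hf : ∀ i j, 0 ≤ f i j) (hE : ∀ i, MeasurableSet (E i))
    (hh : ∀ j, 0 ≤ h j) (hle : ∀ᵐ x ∂μ, ∑ i, (E i).indicator (fun _ => f i) x ≤ h)
    (S : ∀ j, Y j →ₗ[ℝ] (X →ₘ[μ] ℝ)) (hS : ∀ j, ∀ g : Y j, 0 ≤ g → ∀ᵐ x ∂μ, 0 ≤ S j g x)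
    (hTS : ∀ f : ∀ j, Y j, (∀ j, 0 ≤ f j) → ∀ᵐ x ∂μ, T f x ≤ ∏ j, S j (f j) x)
    (hST : ∀ᵐ x ∂μ, ∏ j, S j (h j) x ≤ (B : ℝ) ^ d * T h x) :
    ∑ i, ∫⁻ x in E i, weightedRoot T M (f i) x ∂μ ≤ B * ∫⁻ x, weightedRoot T M h x ∂μ := by
  classical
  have hd' : (d : ℝ) ≠ 0 := by positivity
  have hsum : ∀ᵐ x ∂μ, ∀ (s : Finset (Fin n)) j, ∑ i ∈ s, f i j ≤ h j →
      ∑ i ∈ s, S j (f i j) x ≤ S j (h j) x := by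
    simp only [ae_all_iff]
    intro s j hs
    exact ae_sum_le_of_sum_le (S j) (hS j) (fun i => f i j) s hs
  have hpt : ∀ᵐ x ∂μ, ∑ i, (E i).indicator (weightedRoot T M (f i)) x ≤
      B * weightedRoot T M h x := by
    filter_upwards [hM, hle, hST, hpos h hh, ae_all_iff.2 fun i => hpos (f i) (hf i),
      ae_all_iff.2 fun i => hTS (f i) (hf i), hsum,
      ae_all_iff.2 fun i => ae_all_iff.2 fun j => hS j (f i j) (hf i j)]
      with x h0 h1 h2 h3 h4 h5 h6 h7
    simp only [Set.indicator_apply, ← Finset.sum_filter] at h1 ⊢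
    set s := Finset.univ.filter fun i => x ∈ E i
    have h8 : ∀ j, ∑ i ∈ s, S j (f i j) x ≤ S j (h j) x := fun j =>
      h6 s j (by simpa using h1 j)
    have h9 : ∑ i ∈ s, (T (f i) x) ^ (1 / (d : ℝ)) ≤ B * (T h x) ^ (1 / (d : ℝ)) :=
      calc ∑ i ∈ s, (T (f i) x) ^ (1 / (d : ℝ))
          ≤ ∑ i ∈ s, (∏ j, S j (f i j) x) ^ (1 / (d : ℝ)) := by
            gcongr with i _
            exacts [h4 i, h5 i]
        _ ≤ (∏ j, ∑ i ∈ s, S j (f i j) x) ^ (1 / (d : ℝ)) :=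
            sum_geomMean_le s hd _ fun i _ j => h7 i j
        _ ≤ ((B : ℝ) ^ d * T h x) ^ (1 / (d : ℝ)) := by
            have h10 : ∀ j, 0 ≤ ∑ i ∈ s, S j (f i j) x :=
              fun j => Finset.sum_nonneg fun i _ => h7 i j
            refine Real.rpow_le_rpow (Finset.prod_nonneg fun j _ => h10 j) ?_ (by positivity)
            exact (Finset.prod_le_prod (fun j _ => h10 j) fun j _ => h8 j).trans h2
        _ = B * (T h x) ^ (1 / (d : ℝ)) := by
            rw [Real.mul_rpow (by positivity) h3, ← Real.rpow_natCast,
              ← Real.rpow_mul B.coe_nonneg, mul_one_div_cancel hd', Real.rpow_one]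
    simp only [weightedRoot]
    rw [← ENNReal.ofReal_sum_of_nonneg fun i _ => mul_nonneg h0 (Real.rpow_nonneg (h4 i) _),
      ← Finset.mul_sum, ← ENNReal.ofReal_coe_nnreal (p := B), ← ENNReal.ofReal_mul B.coe_nonneg]
    refine ENNReal.ofReal_le_ofReal ?_
    calc M x * ∑ i ∈ s, (T (f i) x) ^ (1 / (d : ℝ))
        ≤ M x * (B * (T h x) ^ (1 / (d : ℝ))) := mul_le_mul_of_nonneg_left h9 h0
      _ = _ := by ring
  calc ∑ i, ∫⁻ x in E i, weightedRoot T M (f i) x ∂μ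
      = ∫⁻ x, ∑ i, (E i).indicator (weightedRoot T M (f i)) x ∂μ := by
        rw [lintegral_finsetSum' _ fun i _ =>
          (aemeasurable_weightedRoot T hMm (f i)).indicator (hE i)]
        exact Finset.sum_congr rfl fun i _ => (lintegral_indicator (hE i) _).symm
    _ ≤ ∫⁻ x, B * weightedRoot T M h x ∂μ := lintegral_mono_ae hpt
    _ = _ := lintegral_const_mul'' _ (aemeasurable_weightedRoot T hMm h)

/-- The key inequality: if `∑ᵢ 1_{Eᵢ} fᵢ ≤ h` a.e., then the integrals of the weighted roots of the
`fᵢ` over the `Eᵢ` sum to at most `A B ∏ⱼ ‖hⱼ‖^{1/d}`. A tuple `h'` close to `h` for which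
dominating operators exist need not lie above `∑ᵢ 1_{Eᵢ} fᵢ`, but it does after each `fᵢ` is
replaced by `(fᵢ - |h - h'|)⁺`. -/
lemma sum_setLIntegral_weightedRoot_le [∀ j, HasSolidNorm (Y j)] (hd : 1 ≤ d)
    (hpos : IsPositive T) (hbound : NormBound T q A) (hstruct : StructuralHypothesis T B)
    (hqq' : ENNReal.HolderConjugate q q') (M : Lp ℝ q' μ) (hM : ∀ᵐ x ∂μ, 0 ≤ M x)
    (hM1 : ‖M‖ = 1) {n : ℕ} {f : Fin n → ∀ j, Y j} {E : Fin n → Set X} {h : ∀ j, Y j}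
    (hf : ∀ i j, 0 ≤ f i j) (hE : ∀ i, MeasurableSet (E i)) (hh : ∀ j, 0 ≤ h j)
    (hle : ∀ᵐ x ∂μ, ∑ i, (E i).indicator (fun _ => f i) x ≤ h) :
    ∑ i, ∫⁻ x in E i, weightedRoot T M (f i) x ∂μ ≤
      ENNReal.ofReal (B * (A * (∏ j, ‖h j‖) ^ (1 / (d : ℝ)))) := by
  classical
  obtain ⟨D, hD, hDS⟩ := hstruct
  have hdpos : (0 : ℝ) < 1 / d := by positivity
  let F : ℝ → ℝ := fun ε => B * (A * (∏ j, (‖h j‖ + ε)) ^ (1 / (d : ℝ))) +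
    ∑ i, 2 ^ d * (A * (ε * ∏ j, (‖f i j‖ + 1)) ^ (1 / (d : ℝ)))
  have hFc : Continuous F := by
    refine .add (continuous_const.mul (continuous_const.mul (Continuous.rpow_const (by fun_prop)
      fun _ => .inr hdpos.le))) (continuous_finsetSum _ fun i _ => continuous_const.mul
      (continuous_const.mul (Continuous.rpow_const (by fun_prop) fun _ => .inr hdpos.le)))
  have hF0 : F 0 = B * (A * (∏ j, ‖h j‖) ^ (1 / (d : ℝ))) := by
    simp [F, Real.zero_rpow (by simpa using hdpos.ne' : (d : ℝ)⁻¹ ≠ 0)]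
  have key : ∀ ε : ℝ, 0 < ε → ε ≤ 1 →
      ∑ i, ∫⁻ x in E i, weightedRoot T M (f i) x ∂μ ≤ ENNReal.ofReal (F ε) := by
    intro ε hε hε1
    obtain ⟨h', ⟨hh'D, hh'⟩, hdist⟩ := Metric.mem_closure_iff.1 (hD hh) ε hε
    set e : ∀ j, Y j := |h - h'| with he
    have he0 : 0 ≤ e := abs_nonneg _
    have hediff : ∀ j, ‖h j - h' j‖ ≤ ε := fun j => by
      rw [← dist_eq_norm]; exact (dist_le_pi_dist h h' j).trans hdist.le
    have hen : ∀ j, ‖e j‖ ≤ ε := fun j => by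
      rw [he, Pi.abs_apply, norm_abs_eq_norm, Pi.sub_apply]; exact hediff j
    set g : Fin n → ∀ j, Y j := fun i => (f i - e)⁺ with hg
    have hg0 : ∀ i j, 0 ≤ g i j := fun i j => posPart_nonneg (f i - e) j
    have hgf : ∀ i, g i ≤ f i := fun i =>
      sup_le (sub_le_self _ he0) (fun j => hf i j)
    have hr0 : ∀ i, 0 ≤ f i - g i := fun i => sub_nonneg.2 (hgf i)
    have hre : ∀ i, f i - g i ≤ e := fun i => sub_le_comm.1 (le_posPart _)
    have hsolid : ∀ j (a b : Y j), 0 ≤ a → a ≤ b → ‖a‖ ≤ ‖b‖ := fun j a b ha hab =>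
      norm_le_norm_of_abs_le_abs (by rwa [abs_of_nonneg ha, abs_of_nonneg (ha.trans hab)])
    have hle' : ∀ᵐ x ∂μ, ∑ i, (E i).indicator (fun _ => g i) x ≤ h' := by
      filter_upwards [hle] with x hx
      simp only [Set.indicator_apply, ← Finset.sum_filter] at hx ⊢
      refine (sum_posPart_sub_le _ _ (fun i _ => hf i) he0).trans (sup_le ?_ hh')
      rw [sub_le_iff_le_add']
      refine hx.trans ?_
      rw [← sub_le_iff_le_add]
      exact le_abs_self _
    obtain ⟨S, hS, hTS, hST⟩ := hDS h' hh'D hh'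
    have h1 := sum_setLIntegral_weightedRoot_le_of_dominated hd hpos (Lp.aestronglyMeasurable M) hM
      hg0 hE hh' hle' S hS hTS hST
    have h2 : ∀ i, ∫⁻ x in E i, weightedRoot T M (f i) x ∂μ ≤
        ∫⁻ x in E i, weightedRoot T M (g i) x ∂μ +
          ENNReal.ofReal (2 ^ d * (A * (ε * ∏ j, (‖f i j‖ + 1)) ^ (1 / (d : ℝ)))) := fun i => by
      have := setLIntegral_weightedRoot_le_add hd hpos hbound hqq' M hM hM1 (f := f i) (hg0 i)
        (hr0 i) hε.le hε1 (fun j => hsolid j _ _ (hg0 i j) (hgf i j))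
        (fun j => (hsolid j _ _ (hr0 i j) (hre i j)).trans (hen j)) (E i)
      rwa [add_sub_cancel] at this
    refine (Finset.sum_le_sum fun i _ => h2 i).trans ?_
    rw [Finset.sum_add_distrib, ← ENNReal.ofReal_sum_of_nonneg fun i _ => by positivity]
    simp only [F]
    rw [ENNReal.ofReal_add (by positivity) (by positivity), ENNReal.ofReal_mul B.coe_nonneg,
      ENNReal.ofReal_coe_nnreal]
    gcongr
    refine h1.trans ?_
    gcongr
    refine (lintegral_weightedRoot_le hbound hqq' M hM1 hh').trans ?_
    gcongr with j
    calc ‖h' j‖ = ‖h j - (h j - h' j)‖ := by rw [sub_sub_cancel]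
      _ ≤ ‖h j‖ + ‖h j - h' j‖ := norm_sub_le _ _
      _ ≤ ‖h j‖ + ε := by gcongr; exact hediff j
  rw [← hF0]
  have hlim : Filter.Tendsto (fun ε => ENNReal.ofReal (F ε)) (nhdsWithin 0 (Set.Ioi 0))
      (nhds (ENNReal.ofReal (F 0))) :=
    ((ENNReal.continuous_ofReal.comp hFc).tendsto 0).mono_left nhdsWithin_le_nhds
  refine ge_of_tendsto hlim ?_
  filter_upwards [Ioc_mem_nhdsGT (zero_lt_one' ℝ)] with ε hε
  exact key ε hε.1 hε.2

end

/-! ### Construction of the factorising operators -/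

/-- An arithmetic-mean bound that holds after every rational rescaling of the factors gives a
geometric-mean bound. -/
lemma pow_mul_le_prod_of_forall_rat {d : ℕ} (hd : 1 ≤ d) {c τ : ℝ} (hc : 0 ≤ c) (hτ : 0 ≤ τ)
    {a : Fin d → ℝ} (ha : ∀ j, 0 ≤ a j)
    (h : ∀ t : Fin d → ℚ, (∀ j, 0 < t j) →
      d * (c * ((∏ j, (t j : ℝ)) * τ) ^ (1 / (d : ℝ))) ≤ ∑ j, t j * a j) :
    c ^ d * τ ≤ ∏ j, a j := by
  have hd0 : (0 : ℝ) < d := by positivity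
  have key : ∀ δ : ℝ, 0 < δ → c ^ d * τ ≤ ∏ j, (a j + δ) := by
    intro δ hδ
    choose s hs1 hs2 using fun j => exists_rat_btwn (lt_add_of_pos_right (a j) hδ)
    have hs0 : ∀ j, (0 : ℝ) < s j := fun j => (ha j).trans_lt (hs1 j)
    -- The choice `tⱼ = 1 / sⱼ` makes every summand on the right at most `1`.
    have h1 := h (fun j => (s j)⁻¹) fun j => inv_pos.2 (by exact_mod_cast hs0 j)
    have h2 : ∑ j, (((s j)⁻¹ : ℚ) : ℝ) * a j ≤ d := by
      refine (Finset.sum_le_card_nsmul _ _ 1 fun j _ => ?_).trans (by simp)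
      rw [Rat.cast_inv, inv_mul_le_one₀ (hs0 j)]
      exact (hs1 j).le
    have hP : 0 ≤ ∏ j, (((s j)⁻¹ : ℚ) : ℝ) := Finset.prod_nonneg fun j _ => by
      rw [Rat.cast_inv]; exact (inv_pos.2 (hs0 j)).le
    have h3 : c * ((∏ j, (((s j)⁻¹ : ℚ) : ℝ)) * τ) ^ (1 / (d : ℝ)) ≤ 1 := by
      have := h1.trans h2
      nlinarith
    have h4 := pow_le_one₀ (n := d) (mul_nonneg hc (Real.rpow_nonneg (mul_nonneg hP hτ) _)) h3
    rw [mul_pow, ← Real.rpow_natCast (_ ^ (1 / (d : ℝ))), ← Real.rpow_mul (mul_nonneg hP hτ),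
      one_div_mul_cancel hd0.ne', Real.rpow_one] at h4
    have h5 : ∏ j, (((s j)⁻¹ : ℚ) : ℝ) = (∏ j, (s j : ℝ))⁻¹ := by
      simp [Finset.prod_inv_distrib]
    have h6 : 0 < ∏ j, (s j : ℝ) := Finset.prod_pos fun j _ => hs0 j
    rw [h5, mul_left_comm, inv_mul_le_one₀ h6] at h4
    exact h4.trans (Finset.prod_le_prod (fun j _ => (hs0 j).le) fun j _ => (hs2 j).le)
  have hc' : Continuous fun δ : ℝ => ∏ j, (a j + δ) := by fun_prop
  have hlim : Filter.Tendsto (fun δ : ℝ => ∏ j, (a j + δ)) (nhdsWithin 0 (Set.Ioi 0))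
      (nhds (∏ j, (a j + 0))) := (hc'.tendsto 0).mono_left nhdsWithin_le_nhds
  simp only [add_zero] at hlim
  refine ge_of_tendsto hlim ?_
  filter_upwards [self_mem_nhdsWithin] with δ hδ
  exact key δ hδ

section

variable {X : Type*} [MeasurableSpace X] {μ : Measure X} {W Z : Type*} [AddCommGroup W]
  [Module ℝ W] [AddCommGroup Z] [Module ℝ Z]

/-- The set functions `s ↦ φ (1_s ⊗ u g)` attached to a functional `φ` on `W`-valued simple
functions and a linear map `u : Z → W`. The value on nonmeasurable sets is `0`. -/
noncomputable def setFunctional (φ : SimpleFunc X W →ₗ[ℝ] ℝ) (u : Z →ₗ[ℝ] W) :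
    Z →ₗ[ℝ] Set X → ℝ where
  toFun g s := φ ((SimpleFunc.const X (u g)).restrict s)
  map_add' a b := by
    funext s
    rw [Pi.add_apply, ← map_add]
    congr 1
    ext x
    by_cases hs : MeasurableSet s
    · by_cases hx : x ∈ s <;> simp [SimpleFunc.restrict_apply _ hs, hx]
    · simp [SimpleFunc.restrict_of_not_measurable hs]
  map_smul' c a := by
    funext s
    rw [Pi.smul_apply, RingHom.id_apply, ← map_smul]
    congr 1
    ext x
    by_cases hs : MeasurableSet s
    · by_cases hx : x ∈ s <;> simp [SimpleFunc.restrict_apply _ hs, hx]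
    · simp [SimpleFunc.restrict_of_not_measurable hs]

lemma setFunctional_apply (φ : SimpleFunc X W →ₗ[ℝ] ℝ) (u : Z →ₗ[ℝ] W) (g : Z) (s : Set X) :
    setFunctional φ u g s = φ ((SimpleFunc.const X (u g)).restrict s) := rfl

variable [Lattice W] {φ : SimpleFunc X W →ₗ[ℝ] ℝ}

lemma setFunctional_null (hφ : ∀ G, (∀ᵐ x ∂μ, G x ≤ 0) → φ G ≤ 0) (u : Z →ₗ[ℝ] W) (g : Z)
    {s : Set X} (hs : MeasurableSet s) (h0 : μ s = 0) : setFunctional φ u g s ≤ 0 := by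
  refine hφ _ ?_
  filter_upwards [measure_eq_zero_iff_ae_notMem.1 h0] with x hx
  rw [SimpleFunc.restrict_apply _ hs]
  simp [hx]

variable [IsOrderedAddMonoid W]

lemma setFunctional_nonneg (hφ : ∀ G, (∀ᵐ x ∂μ, G x ≤ 0) → φ G ≤ 0) (u : Z →ₗ[ℝ] W) {g : Z}
    (hg : 0 ≤ u g) {s : Set X} (hs : MeasurableSet s) : 0 ≤ setFunctional φ u g s := by
  have := hφ (-(SimpleFunc.const X (u g)).restrict s) (.of_forall fun x => by
    rw [SimpleFunc.coe_neg, Pi.neg_apply, SimpleFunc.restrict_apply _ hs]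
    by_cases hx : x ∈ s <;> simp [hx, hg])
  rw [map_neg] at this
  rw [setFunctional_apply]
  linarith

lemma isFinitelyAdditive_setFunctional (hφ : ∀ G, (∀ᵐ x ∂μ, G x ≤ 0) → φ G ≤ 0) (u : Z →ₗ[ℝ] W)
    {g : Z} (hg : 0 ≤ u g) :
    IsFinitelyAdditive fun s => ENNReal.ofReal (setFunctional φ u g s) where
  empty := by simpa using setFunctional_null hφ u g .empty measure_empty
  union s t hs ht hst := by
    rw [← ENNReal.ofReal_add (setFunctional_nonneg hφ u hg hs) (setFunctional_nonneg hφ u hg ht)]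
    simp only [setFunctional_apply]
    rw [← map_add]
    congr 2
    ext x
    rw [SimpleFunc.coe_add, Pi.add_apply, SimpleFunc.restrict_apply _ hs,
      SimpleFunc.restrict_apply _ ht, SimpleFunc.restrict_apply _ (hs.union ht)]
    exact congrFun (Set.indicator_union_of_disjoint hst _) x

end

section

variable {X : Type*} [MeasurableSpace X] {μ : Measure X} {d : ℕ} {Y : Fin d → Type*}
  [∀ j, NormedAddCommGroup (Y j)] [∀ j, NormedSpace ℝ (Y j)]
  {T : MultilinearMap ℝ Y (X →ₘ[μ] ℝ)}

/-- Comparing densities: if the set functions attached to `f` dominate `d ∫_s M T(f)^{1/d}`, so do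
their countably additive parts, since the left side is a measure. -/
lemma ae_weightedRoot_le_sum [SigmaFinite μ] {M : X → ℝ} (hMm : AEStronglyMeasurable M μ)
    (f : ∀ j, Y j) {m : Fin d → Set X → ℝ≥0∞} (hm : ∀ j, IsFinitelyAdditive (m j))
    {ρ : Fin d → X → ℝ} (hρm : ∀ j, AEMeasurable (ρ j) μ)
    (hρ : ∀ j s, MeasurableSet s →
      ∫⁻ x in s, ENNReal.ofReal (ρ j x) ∂μ = countablyAdditivePart (m j) (hm j) s)
    (hle : ∀ s, MeasurableSet s → d * ∫⁻ x in s, weightedRoot T M f x ∂μ ≤ ∑ j, m j s) :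
    ∀ᵐ x ∂μ, d * weightedRoot T M f x ≤ ∑ j, ENNReal.ofReal (ρ j x) := by
  have hw := aemeasurable_weightedRoot T hMm f
  have hκ : μ.withDensity (fun x => d * weightedRoot T M f x) ≤
      ∑ j, countablyAdditivePart (m j) (hm j) := by
    rw [← countablyAdditivePart_finsetSum Finset.univ hm]
    refine le_countablyAdditivePart _ _ fun s hs => ?_
    rw [withDensity_apply _ hs, lintegral_const_mul'' _ hw.restrict, Finset.sum_apply]
    exact hle s hs
  refine ae_le_of_forall_setLIntegral_le_of_sigmaFinite₀ (hw.const_mul _) fun s hs _ => ?_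
  rw [lintegral_finsetSum' _ fun j _ => (hρm j).ennreal_ofReal.restrict]
  have := Measure.le_iff.1 hκ s hs
  rw [withDensity_apply _ hs, Measure.finsetSum_apply] at this
  simpa only [hρ _ s hs] using this

variable [∀ j, Lattice (Y j)] [∀ j, IsOrderedAddMonoid (Y j)] [∀ j, IsOrderedModule ℝ (Y j)]
  [∀ j, HasSolidNorm (Y j)] {q q' : ℝ≥0∞} {A B : ℝ≥0}

/-- The linear form of the problem: a functional on simple functions whose components are bounded
by `A B` and which dominates `d ∫_s M T(f)^{1/d}`. -/
lemma exists_functional_ge_weightedRoot (hd : 1 ≤ d)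
    (hpos : IsPositive T) (hbound : NormBound T q A) (hstruct : StructuralHypothesis T B)
    (hqq' : ENNReal.HolderConjugate q q') (M : Lp ℝ q' μ) (hM : ∀ᵐ x ∂μ, 0 ≤ M x)
    (hM1 : ‖M‖ = 1) :
    ∃ φ : SimpleFunc X (∀ j, Y j) →ₗ[ℝ] ℝ, (∀ G, (∀ᵐ x ∂μ, G x ≤ 0) → φ G ≤ 0) ∧
      (∀ h, 0 ≤ h → φ (SimpleFunc.const X h) ≤ A * B * ∑ j, ‖h j‖) ∧
      ∀ f s, 0 ≤ f → MeasurableSet s → d * (∫⁻ x in s, weightedRoot T M f x ∂μ).toReal ≤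
        φ ((SimpleFunc.const X f).restrict s) := by
  have hd0 : (0 : ℝ) < d := by positivity
  have hfin : ∀ f s, 0 ≤ f → ∫⁻ x in s, weightedRoot T M f x ∂μ ≠ ∞ := fun f s hf =>
    ((setLIntegral_le_lintegral _ _).trans_lt
      ((lintegral_weightedRoot_le hbound hqq' M hM1 hf).trans_lt ENNReal.ofReal_lt_top)).ne
  refine exists_separating_functional μ
    (fun f s => d * (∫⁻ x in s, weightedRoot T M f x ∂μ).toReal) (fun h => A * B * ∑ j, ‖h j‖)
    ?_ ?_ ?_ ?_
  · intro c f s hc hf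
    rw [lintegral_congr_ae (ae_restrict_of_ae (weightedRoot_smul hd hpos hc hf)),
      lintegral_const_mul'' _ (aemeasurable_weightedRoot T (Lp.aestronglyMeasurable M) f).restrict,
      ENNReal.toReal_mul, ENNReal.toReal_ofReal hc]
    ring
  · intro a b _ _
    rw [← mul_add, ← Finset.sum_add_distrib]
    gcongr
    exact norm_add_le _ _
  · intro c a hc _
    simp only [Pi.smul_apply, norm_smul, Real.norm_of_nonneg hc, ← Finset.mul_sum]
    ring
  · intro n f E h hf hE hh hle
    have h1 := sum_setLIntegral_weightedRoot_le hd hpos hbound hstruct hqq' M hM hM1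
      hf hE hh hle
    have h2 := ENNReal.toReal_le_of_le_ofReal (by positivity) h1
    rw [ENNReal.toReal_sum fun i _ => hfin (f i) (E i) (hf i)] at h2
    rw [← Finset.mul_sum]
    calc (d : ℝ) * ∑ i, (∫⁻ x in E i, weightedRoot T M (f i) x ∂μ).toReal
        ≤ d * (B * (A * ((1 / (d : ℝ)) * ∑ j, ‖h j‖))) := by
          gcongr
          refine h2.trans ?_
          gcongr
          exact geomMean_le hd _ fun j => norm_nonneg _
      _ = A * B * ∑ j, ‖h j‖ := by field_simp

end

end MultilinearDuality

theorem theorem1 {X : Type*} [MeasurableSpace X] (μ : Measure X) [SigmaFinite μ]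
    (d : ℕ) (hd : 1 ≤ d) (Y : Fin d → Type*)
    [∀ j, NormedAddCommGroup (Y j)] [∀ j, NormedSpace ℝ (Y j)] [∀ j, Lattice (Y j)]
    [∀ j, IsOrderedAddMonoid (Y j)] [∀ j, IsOrderedModule ℝ (Y j)] [∀ j, HasSolidNorm (Y j)]
    (T : MultilinearMap ℝ Y (X →ₘ[μ] ℝ))
    (hpos : MultilinearDuality.IsPositive T) (hsat : MultilinearDuality.Saturates T)
    (q q' : ℝ≥0∞) (hqq' : ENNReal.HolderConjugate q q') (A B : ℝ≥0)
    (hbound : MultilinearDuality.NormBound T q A)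
    (hstruct : MultilinearDuality.StructuralHypothesis T B)
    (M : Lp ℝ q' μ) (hM : ∀ᵐ x ∂μ, 0 ≤ M x) (hM1 : ‖M‖ = 1) :
    ∃ R : ∀ j, Y j →L[ℝ] Lp ℝ 1 μ,
      (∀ j, ∀ g : Y j, 0 ≤ g → ∀ᵐ x ∂μ, 0 ≤ R j g x) ∧
      (∀ f : ∀ j, Y j, (∀ j, 0 ≤ f j) →
        ∀ᵐ x ∂μ, (M x) ^ d * T f x ≤ ∏ j, R j (f j) x) ∧
      ∀ j, ‖R j‖ ≤ A * B := by
  open MultilinearDuality in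
  obtain ⟨φ, hφ, hφnorm, hφT⟩ :=
    exists_functional_ge_weightedRoot hd hpos hbound hstruct hqq' M hM hM1
  let u : ∀ j, Y j →ₗ[ℝ] ∀ j, Y j := fun j => LinearMap.single ℝ Y j
  have hu : ∀ j (g : Y j), 0 ≤ g → 0 ≤ u j g := fun j g hg => by
    simpa [u] using (Pi.single_nonneg.2 hg)
  have hR := fun j => exists_clm_countablyAdditivePart μ (setFunctional φ (u j))
    (fun g s hg hs => setFunctional_nonneg hφ (u j) (hu j g hg) hs)
    (fun g hg => isFinitelyAdditive_setFunctional hφ (u j) (hu j g hg))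
    (fun g s hg hs h0 => setFunctional_null hφ (u j) g hs h0) (A * B)
    (fun g hg => by
      rw [setFunctional_apply, SimpleFunc.restrict_univ]
      refine (hφnorm _ (hu j g hg)).trans (le_of_eq ?_)
      rw [Finset.sum_eq_single j (fun k _ hk => by simp [u, hk]) (by simp)]
      simp [u])
  choose R hRnorm hRpos hRset using hR
  refine ⟨R, hRpos, fun f hf => ?_, fun j => by simpa using hRnorm j⟩
  -- For every nonnegative tuple the arithmetic mean of the `R j (f j)` dominates `M T(f)^{1/d}`.
  have hmean : ∀ f : ∀ j, Y j, (∀ j, 0 ≤ f j) →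
      ∀ᵐ x ∂μ, d * (M x * (T f x) ^ (1 / (d : ℝ))) ≤ ∑ j, R j (f j) x := by
    intro f hf
    have h1 := ae_weightedRoot_le_sum (T := T) (Lp.aestronglyMeasurable M) f
      (fun j => isFinitelyAdditive_setFunctional hφ (u j) (hu j (f j) (hf j)))
      (fun j => (Lp.aestronglyMeasurable (R j (f j))).aemeasurable)
      (fun j s hs => hRset j (f j) (hf j) s hs) (fun s hs => by
        have hsum : ∑ j, setFunctional φ (u j) (f j) s =
            φ ((SimpleFunc.const X f).restrict s) := by
          have h1 : ∀ j, setFunctional φ (u j) (f j) s =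
              setFunctional φ LinearMap.id (u j (f j)) s := fun j => rfl
          have h2 : ∑ j, u j (f j) = f := Finset.univ_sum_single f
          simp only [h1]
          rw [← Finset.sum_apply, ← map_sum, h2]
          rfl
        rw [← ENNReal.ofReal_sum_of_nonneg
          fun j _ => setFunctional_nonneg hφ (u j) (hu j (f j) (hf j)) hs, hsum]
        have hfin : ∫⁻ x in s, weightedRoot T M f x ∂μ ≠ ∞ :=
          ((setLIntegral_le_lintegral _ _).trans_lt
            ((lintegral_weightedRoot_le hbound hqq' M hM1 hf).trans_lt ENNReal.ofReal_lt_top)).ne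
        refine le_trans (le_of_eq ?_) (ENNReal.ofReal_le_ofReal (hφT f s hf hs))
        rw [ENNReal.ofReal_mul (by positivity), ENNReal.ofReal_natCast,
          ENNReal.ofReal_toReal hfin])
    filter_upwards [h1, ae_all_iff.2 fun j => hRpos j (f j) (hf j)] with x h2 h3
    rw [← ENNReal.ofReal_sum_of_nonneg fun j _ => h3 j, weightedRoot, ← ENNReal.ofReal_natCast,
      ← ENNReal.ofReal_mul (by positivity)] at h2
    exact (ENNReal.ofReal_le_ofReal_iff (Finset.sum_nonneg fun j _ => h3 j)).1 h2
  have hresc : ∀ᵐ x ∂μ, ∀ t : Fin d → ℚ, (∀ j, 0 < t j) →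
      d * (M x * ((∏ j, (t j : ℝ)) * T f x) ^ (1 / (d : ℝ))) ≤ ∑ j, t j * R j (f j) x := by
    refine ae_all_iff.2 fun t => ?_
    by_cases ht : ∀ j, 0 < t j
    · have ht' : ∀ j, (0 : ℝ) ≤ t j := fun j => by exact_mod_cast (ht j).le
      have h1 := hmean (fun j => (t j : ℝ) • f j) fun j => smul_nonneg (ht' j) (hf j)
      rw [T.map_smul_univ] at h1
      simp only [map_smul] at h1
      filter_upwards [h1, AEEqFun.coeFn_smul (∏ j, (t j : ℝ)) (T f),
        ae_all_iff.2 fun j => Lp.coeFn_smul (t j : ℝ) (R j (f j))] with x h2 h3 h4 _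
      simpa only [h3, h4, Pi.smul_apply, smul_eq_mul] using h2
    · exact .of_forall fun x h => absurd h ht
  filter_upwards [hM, hpos f hf, hresc, ae_all_iff.2 fun j => hRpos j (f j) (hf j)]
    with x h1 h2 h3 h4
  exact pow_mul_le_prod_of_forall_rat hd h1 h2 h4 h3
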